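/- **Distributed List Update.** Let $V$ be a set of $n$ nodes. A *configuration* is a bijection $h\colon V\to\{1,\dots,n\}$, where $\{1,\dots,n\}$ is the vertex set of the line network (path) with edges $\{i,i+1\}$. A request $(u,v)\in V\times V$ is served in configuration $h$ at cost $|h(u)-h(v)|$. A *migration* swaps the images under $h$ of two nodes placed on adjacent vertices of the line; the reconfiguration cost from $h$ to $h'$ is the least number of migrations that turn $h$ into $h'$. The cost of serving a sequence $\sigma=(\sigma_1,\dots,\sigma_m)$ of requests by configurations $h_1,\dots,h_m$ is the sum of the costs of serving $\sigma_i$ in $h_i$ plus the sum of the reconfiguration costs from $h_i$ to $h_{i+1}$; either the first configuration can be chosen freely, or an initial configuration $h_0$, common to all algorithms, is prescribed and the reconfiguration cost from $h_0$ to $h_1$ is added. A deterministic online algorithm $\mathrm{ON}$ chooses $h_i$ as a function of $\sigma_1,\dots,\sigma_i$ only (and of the prescribed $h_0$, if there is one); $\mathrm{cost}(\mathrm{OFF}(\sigma))$ is the minimum cost of serving $\sigma$ over all choices of $h_1,\dots,h_m$. The request graph $R(\sigma)$ has vertex set $V$ and the requested pairs as (undirected) edges. **Theorem.** Both for freely chosen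 and for prescribed initial configurations, every deterministic online algorithm for Distributed List Update has competitive ratio $\Omega(\log n)$ on sequences of every length $\Omega(n^2)$; on sequences of length $\Theta(n^2)$ this holds even if the request graph is a line. Precisely: 1. There is a constant $c>0$ such that for every $a>0$ there is an $N$ such that for all $n\ge N$, every initial condition as above, every deterministic online algorithm $\mathrm{ON}$ on $n$ nodes and every integer $m\ge a n^2$ there is a sequence $\sigma$ of exactly $m$ requests between distinct nodes, with $$\frac{\mathrm{cost}(\mathrm{ON}(\sigma))}{\mathrm{cost}(\mathrm{OFF}(\sigma))}\ \ge\ c\log n .$$ 2. For every $b>0$ there is a constant $c>0$ such that for every $a>0$ there is an $N$ such that for all $n\ge N$, every initial condition as above, every deterministic online algorithm $\mathrm{ON}$ on $n$ nodes and every integer $m$ with $a n^2\le m\le b n^2$ there is a sequence $\sigma$ of exactly $m$ requests between distinct nodes whose request graph $R(\sigma)$ is a line (a path through all $n$ nodes), with $$\frac{\mathrm{cost}(\mathrm{ON}(\sigma))}{\mathrm{cost}(\mathrm{OFF}(\sigma))}\ \ge\ c\log n .$$ -/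

import Mathlib

open scoped BigOperators

namespace DistributedListUpdate

/-- A configuration of the `n` nodes `V` on the list network with vertices `0, 1, …, n - 1`
(an injection of an `n`-element set into an `n`-element set is a bijection). -/
abbrev Configuration (V : Type*) (n : ℕ) : Type _ := V ≃ Fin n

/-- A communication request is a pair of nodes. -/
abbrev Request (V : Type*) : Type _ := V × V

variable {V : Type*} {n : ℕ}

/-- The cost `|h(u) - h(v)|` of serving the request `(u, v)` in the configuration `h`. -/
def servingCost (h : Configuration V n) (r : Request V) : ℕ :=
  ((h r.1 : ℤ) - (h r.2 : ℤ)).natAbs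

/-- The graph on all configurations whose edges are the migrations: `h` and `h'` are adjacent when
`h'` arises from `h` by swapping the images of two nodes `u`, `v` placed on adjacent vertices of
the list network. -/
def migrationGraph (V : Type*) (n : ℕ) : SimpleGraph (Configuration V n) where
  Adj h h' := ∃ u v : V, (SimpleGraph.pathGraph n).Adj (h u) (h v) ∧
    h' = h.trans (Equiv.swap (h u) (h v))
  symm := ⟨by
    rintro h _ ⟨u, v, huv, rfl⟩
    refine ⟨u, v, ?_, ?_⟩
    · simpa using huv.symm
    · ext x
      simp [Equiv.swap_comm (h v) (h u)]⟩
  loopless := ⟨by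
    rintro h ⟨u, v, huv, he⟩
    have h1 := congrArg (fun e : V ≃ Fin n => e u) he
    simp only [Equiv.trans_apply, Equiv.swap_apply_left] at h1
    exact huv.ne h1⟩

/-- The migrations connect all configurations, so that their graph distance is the least number of
migrations leading from one to the other. -/
theorem migrationGraph_preconnected (V : Type*) (n : ℕ) : (migrationGraph V n).Preconnected := by
  have key : ∀ (τ : Equiv.Perm (Fin n)) (h : Configuration V n),
      (migrationGraph V n).Reachable h (h.trans τ) := by
    cases n with
    | zero =>
      intro τ h
      rw [Subsingleton.elim τ 1]
      exact SimpleGraph.Reachable.refl _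
    | succ k =>
      intro τ
      have hτ : τ ∈ Submonoid.closure
          (Set.range fun i : Fin k => Equiv.swap i.castSucc i.succ) := by
        rw [Equiv.Perm.mclosure_swap_castSucc_succ]; trivial
      induction hτ using Submonoid.closure_induction with
      | mem x hx =>
        obtain ⟨i, rfl⟩ := hx
        intro h
        refine SimpleGraph.Adj.reachable ⟨h.symm i.castSucc, h.symm i.succ, ?_, ?_⟩
        · simp [SimpleGraph.pathGraph_adj]
        · simp
      | one => exact fun h => SimpleGraph.Reachable.refl _
      | mul x y _ _ hx hy => exact fun h => (hy h).trans (hx (h.trans y))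
  intro h h'
  have := key (h.symm.trans h') h
  rwa [← Equiv.trans_assoc, Equiv.self_trans_symm, Equiv.refl_trans] at this

/-- The least number of migrations needed to change `h` into `h'`. -/
noncomputable def reconfigurationCost (h h' : Configuration V n) : ℕ :=
  (migrationGraph V n).dist h h'

/-- The cost of setting up the first configuration. With `none` the initial configuration can be
chosen freely; with `some s` the network initially is in the configuration `s`. -/
noncomputable def startCost (start : Option (Configuration V n)) (h : Configuration V n) : ℕ :=
  match start with
  | none => 0
  | some s => reconfigurationCost s h

/-- The cost of serving `σ = (σ₀, …, σₘ₋₁)` by the configurations `h 0, …, h (m - 1)`. -/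
noncomputable def scheduleCost (start : Option (Configuration V n)) (σ : List (Request V))
    (h : ℕ → Configuration V n) : ℕ :=
  startCost start (h 0)
    + ∑ i : Fin σ.length, servingCost (h i) (σ.get i)
    + ∑ i ∈ Finset.range (σ.length - 1), reconfigurationCost (h i) (h (i + 1))

/-- The cost of an optimal offline algorithm, which knows all of `σ`. -/
noncomputable def offlineCost (start : Option (Configuration V n)) (σ : List (Request V)) : ℕ :=
  ⨅ h : ℕ → Configuration V n, scheduleCost start σ h

/-- A deterministic online algorithm: from the requests revealed so far (including the current one)
it computes the configuration in which the current request is served. -/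
abbrev OnlineAlgorithm (V : Type*) (n : ℕ) : Type _ := List (Request V) → Configuration V n

/-- The cost of an online algorithm on `σ`. -/
noncomputable def onlineCost (start : Option (Configuration V n)) (A : OnlineAlgorithm V n)
    (σ : List (Request V)) : ℕ :=
  scheduleCost start σ (fun i => A (σ.take (i + 1)))

/-- The ratio `cost(ON(σ)) / cost(OFF(σ))`, whose maximum over `σ` is the competitive ratio. -/
noncomputable def costRatio (start : Option (Configuration V n)) (A : OnlineAlgorithm V n)
    (σ : List (Request V)) : ℝ :=
  (onlineCost start A σ : ℝ) / (offlineCost start σ : ℝ)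

/-- The request graph `R(σ)`. -/
def requestGraph (σ : List (Request V)) : SimpleGraph V :=
  SimpleGraph.fromRel (fun u v => (u, v) ∈ σ)

end DistributedListUpdate

namespace DistributedListUpdate

variable {V : Type*} {n : ℕ}

/-! ### Reconfiguration costs -/

/-! The adversary maintains disjoint paths and requests only their edges. It starts from `2 ^ k`
single nodes, `2 ^ k ≤ n < 2 ^ (k + 1)`, and repeatedly requests an edge of length at least `L` in
the current online configuration. Either this continues until the requests run out, each costing at
least `L`, or at some point all edges are short. Then every path lies close to its first node, and
paths far apart on the list are merged in pairs (`exists_distant_merge`). Making the merged paths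
short again brings order `2 ^ k` nodes closer to their partners by order `2 ^ k`, so it takes order
`n ^ 2` migrations (`mul_le_displacement`, `displacement_le`). About `k / 2` merges are possible
while the paths stay compact, which forces cost of order `n ^ 2 * log n`
(`exists_requests_of_merges`).

All requests lie on one line, so the offline algorithm moves to that line and pays at most `n ^ 2 +
m`. With `L = k ^ 2` the first alternative costs order `m * (log n) ^ 2`; the spare logarithm
absorbs `1 / a`, which makes `c` independent of `a`. Longer sequences are cut into phases of order
`n ^ 2` requests, each with a new line. -/

theorem reconfigurationCost_self (h : Configuration V n) : reconfigurationCost h h = 0 :=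
  SimpleGraph.dist_self

theorem reconfigurationCost_triangle (h₁ h₂ h₃ : Configuration V n) :
    reconfigurationCost h₁ h₃ ≤ reconfigurationCost h₁ h₂ + reconfigurationCost h₂ h₃ :=
  SimpleGraph.Connected.dist_triangle
    ((SimpleGraph.connected_iff _).2 ⟨migrationGraph_preconnected V n, ⟨h₁⟩⟩)

/-- A quantity obeying the triangle inequality and changing by at most `C` per migration is at most
`C` times the reconfiguration cost. -/
theorem le_mul_reconfigurationCost (d : Configuration V n → Configuration V n → ℕ) (C : ℕ)
    (hself : ∀ h, d h h = 0) (htri : ∀ h₁ h₂ h₃, d h₁ h₃ ≤ d h₁ h₂ + d h₂ h₃)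
    (hadj : ∀ h h', (migrationGraph V n).Adj h h' → d h h' ≤ C) (h h' : Configuration V n) :
    d h h' ≤ C * reconfigurationCost h h' := by
  obtain ⟨p, hp⟩ := (migrationGraph_preconnected V n h h').exists_walk_length_eq_dist
  rw [reconfigurationCost, ← hp]
  clear hp
  induction p with
  | nil => simp [hself]
  | @cons a b c hab q ih =>
    have h1 := htri a b c
    have h2 := hadj _ _ hab
    rw [SimpleGraph.Walk.length_cons, mul_add, mul_one]
    omega

/-- The serving cost of a request drops by at most one per migration. -/
theorem servingCost_le_add (r : Request V) (h h' : Configuration V n) :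
    servingCost h r ≤ reconfigurationCost h h' + servingCost h' r := by
  -- The truncated difference of serving costs satisfies the triangle inequality; symmetry is not
  -- needed.
  have key := le_mul_reconfigurationCost (fun h h' => servingCost h r - servingCost h' r) 1
    (by simp) (by intro h₁ h₂ h₃; omega) (by
      rintro h _ ⟨u, v, huv, rfl⟩
      rw [SimpleGraph.pathGraph_adj] at huv
      simp only [servingCost, Equiv.trans_apply, Equiv.swap_apply_def]
      split_ifs with h1 h2 h2 h3 h3 <;> simp_all only [Fin.ext_iff] <;> omega) h h'
  omega

/-- The total displacement of all nodes between two configurations. -/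
def displacement [Fintype V] (h h' : Configuration V n) : ℕ :=
  ∑ v : V, ((h v : ℤ) - (h' v : ℤ)).natAbs

/-- A migration displaces two nodes by one each. -/
theorem displacement_le [Fintype V] (h h' : Configuration V n) :
    displacement h h' ≤ 2 * reconfigurationCost h h' := by
  classical
  refine le_mul_reconfigurationCost displacement 2 (by simp [displacement]) ?_ ?_ h h'
  · intro h₁ h₂ h₃
    rw [displacement, displacement, displacement, ← Finset.sum_add_distrib]
    exact Finset.sum_le_sum fun v _ => by omega
  · rintro h _ ⟨u, v, huv, rfl⟩
    rw [SimpleGraph.pathGraph_adj] at huv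
    have hz : ∀ w, ((h w : ℤ) - (h.trans (Equiv.swap (h u) (h v)) w : ℤ)).natAbs
        ≤ if w ∈ ({u, v} : Finset V) then 1 else 0 := by
      intro w
      simp only [Equiv.trans_apply, Equiv.swap_apply_def, Finset.mem_insert, Finset.mem_singleton,
        h.injective.eq_iff]
      split_ifs with h1 h2 h2 <;> simp_all <;> omega
    refine (Finset.sum_le_sum fun w _ => hz w).trans ?_
    rw [← Finset.sum_filter, Finset.sum_const, smul_eq_mul, mul_one]
    refine (Finset.card_le_card ?_).trans (Finset.card_le_two (a := u) (b := v))
    intro w hw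
    exact (Finset.mem_filter.1 hw).2

/-- A node can be moved `d` places down by `d` migrations without touching the places below. -/
theorem exists_move_down (k : ℕ) (v : V) : ∀ (d : ℕ) (h : Configuration V n), (h v : ℕ) = k + d →
    ∃ h' : Configuration V n, reconfigurationCost h h' ≤ d ∧ (h' v : ℕ) = k ∧
      ∀ w, (h w : ℕ) < k → h' w = h w := by
  intro d
  induction d with
  | zero => exact fun h hv => ⟨h, by simp [reconfigurationCost_self], hv, fun _ _ => rfl⟩
  | succ d ih =>
    intro h hv
    have hlt : k + d < n := by have := (h v).isLt; omega
    set u := h.symm ⟨k + d, hlt⟩ with hu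
    have hhu : h u = ⟨k + d, hlt⟩ := by simp [hu]
    obtain ⟨h', h1, h2, h3⟩ := ih (h.trans (Equiv.swap (h u) (h v))) (by simp [hhu])
    refine ⟨h', ?_, h2, ?_⟩
    · have hadj : (migrationGraph V n).Adj h (h.trans (Equiv.swap (h u) (h v))) :=
        ⟨u, v, by rw [SimpleGraph.pathGraph_adj, hhu]; left; simp only; omega, rfl⟩
      have h4 := reconfigurationCost_triangle h (h.trans (Equiv.swap (h u) (h v))) h'
      have h5 : reconfigurationCost h (h.trans (Equiv.swap (h u) (h v))) = 1 :=
        SimpleGraph.dist_eq_one_iff_adj.2 hadj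
      omega
    · intro w hw
      have hw' : (h.trans (Equiv.swap (h u) (h v))) w = h w := by
        rw [Equiv.trans_apply, Equiv.swap_apply_of_ne_of_ne]
        · intro hc; rw [hc, hhu] at hw; simp at hw
        · intro hc; rw [hc] at hw; omega
      rw [h3 w (by rw [hw']; exact hw), hw']

/-- Selection sort: positions are filled from the bottom, each by moving one node down at most `n`
places. -/
theorem reconfigurationCost_le_sq (h h' : Configuration V n) :
    reconfigurationCost h h' ≤ n ^ 2 := by
  have key : ∀ k ≤ n, ∃ g : Configuration V n, reconfigurationCost h g ≤ k * n ∧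
      ∀ w, (h' w : ℕ) < k → g w = h' w := by
    intro k
    induction k with
    | zero => exact fun _ => ⟨h, by simp [reconfigurationCost_self], by simp⟩
    | succ k ih =>
      intro hk
      obtain ⟨g, hg, hgw⟩ := ih (by omega)
      set v := h'.symm ⟨k, hk⟩ with hv
      have hhv : h' v = ⟨k, hk⟩ := by simp [hv]
      -- The positions below `k` already hold their final nodes, so `v` sits at `k` or higher.
      have hkv : k ≤ (g v : ℕ) := by
        by_contra hlt
        have h1 : g (h'.symm (g v)) = g v := by
          rw [hgw _ (by simp; omega)]; simp
        have h2 : g v = h' v := by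
          conv_lhs => rw [← h'.apply_symm_apply (g v), g.injective h1]
        rw [h2, hhv] at hlt
        simp at hlt
      obtain ⟨g', h1, h2, h3⟩ := exists_move_down k v ((g v : ℕ) - k) g (by omega)
      refine ⟨g', ?_, fun w hw => ?_⟩
      · have h4 := reconfigurationCost_triangle h g g'
        have h5 := (g v).isLt
        rw [add_mul]
        omega
      · rcases Nat.lt_succ_iff_lt_or_eq.1 hw with hw | hw
        · rw [h3 w (by rw [hgw w hw]; exact hw), hgw w hw]
        · have : w = v := h'.injective (by rw [hhv]; exact Fin.ext hw)
          rw [this, hhv]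
          exact Fin.ext h2
  obtain ⟨g, hg, hgw⟩ := key n le_rfl
  have : g = h' := Equiv.ext fun w => hgw w (h' w).isLt
  rw [sq, ← this]
  exact hg

/-! ### Costs of schedules -/

theorem startCost_le_sq (start : Option (Configuration V n)) (h : Configuration V n) :
    startCost start h ≤ n ^ 2 := by
  cases start with
  | none => exact Nat.zero_le _
  | some s => exact reconfigurationCost_le_sq s h

theorem scheduleCost_some_le (s : Configuration V n) (start : Option (Configuration V n))
    (σ : List (Request V)) (h : ℕ → Configuration V n) :
    scheduleCost (some s) σ h ≤ scheduleCost start σ h + n ^ 2 := by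
  have := startCost_le_sq (some s) (h 0)
  unfold scheduleCost
  omega

theorem scheduleCost_some_triangle (s s' : Configuration V n) (σ : List (Request V))
    (h : ℕ → Configuration V n) :
    scheduleCost (some s) σ h ≤ reconfigurationCost s s' + scheduleCost (some s') σ h := by
  have : startCost (some s) (h 0) ≤ reconfigurationCost s s' + startCost (some s') (h 0) :=
    reconfigurationCost_triangle s s' (h 0)
  unfold scheduleCost
  omega

theorem scheduleCost_singleton (s : Configuration V n) (r : Request V)
    (h : ℕ → Configuration V n) :
    scheduleCost (some s) [r] h = reconfigurationCost s (h 0) + servingCost (h 0) r := by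
  simp [scheduleCost, startCost]

theorem scheduleCost_cons_cons (s : Configuration V n) (r r' : Request V) (σ : List (Request V))
    (h : ℕ → Configuration V n) :
    scheduleCost (some s) (r :: r' :: σ) h = reconfigurationCost s (h 0) + servingCost (h 0) r
      + scheduleCost (some (h 0)) (r' :: σ) (fun i => h (i + 1)) := by
  have h1 : ∑ i : Fin (r :: r' :: σ).length, servingCost (h i) ((r :: r' :: σ).get i)
      = servingCost (h 0) r
        + ∑ i : Fin (r' :: σ).length, servingCost (h (i + 1)) ((r' :: σ).get i) :=
    Fin.sum_univ_succ (n := (r' :: σ).length) _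
  have h2 := Finset.sum_range_succ' (fun i => reconfigurationCost (h i) (h (i + 1))) σ.length
  unfold scheduleCost startCost
  simp only [List.length_cons, Nat.add_sub_cancel] at h1 h2 ⊢
  rw [h1, h2]
  simp only [zero_add]
  ring

/-- The cost of the online algorithm `A` on `σ` when `τ` has been served before. -/
noncomputable def onlineCostFrom (A : OnlineAlgorithm V n) :
    List (Request V) → List (Request V) → ℕ
  | _, [] => 0
  | τ, r :: σ => reconfigurationCost (A τ) (A (τ ++ [r])) + servingCost (A (τ ++ [r])) r
      + onlineCostFrom A (τ ++ [r]) σ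

theorem onlineCostFrom_append (A : OnlineAlgorithm V n) (σ σ' : List (Request V)) :
    ∀ τ, onlineCostFrom A τ (σ ++ σ') = onlineCostFrom A τ σ + onlineCostFrom A (τ ++ σ) σ' := by
  induction σ with
  | nil => intro τ; simp [onlineCostFrom]
  | cons r σ ih =>
    intro τ
    simp only [List.cons_append, onlineCostFrom, ih, List.append_assoc, List.nil_append]
    ring

theorem reconfigurationCost_le_onlineCostFrom (A : OnlineAlgorithm V n) (σ : List (Request V)) :
    ∀ τ, reconfigurationCost (A τ) (A (τ ++ σ)) ≤ onlineCostFrom A τ σ := by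
  induction σ with
  | nil => intro τ; simp [reconfigurationCost_self]
  | cons r σ ih =>
    intro τ
    have h1 := reconfigurationCost_triangle (A τ) (A (τ ++ [r])) (A (τ ++ (r :: σ)))
    have h2 := ih (τ ++ [r])
    rw [List.append_assoc, List.singleton_append] at h2
    rw [onlineCostFrom]
    omega

/-- The adversary judges a request by the configuration before it is revealed. Moving first does not
help the algorithm, since a migration saves at most one unit of serving cost. -/
theorem servingCost_add_le_onlineCostFrom_cons (A : OnlineAlgorithm V n) (τ σ : List (Request V))
    (r : Request V) :
    servingCost (A τ) r + onlineCostFrom A (τ ++ [r]) σ ≤ onlineCostFrom A τ (r :: σ) := by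
  have := servingCost_le_add r (A τ) (A (τ ++ [r]))
  rw [onlineCostFrom]
  omega

theorem onlineCostFrom_eq_scheduleCost (A : OnlineAlgorithm V n) (σ : List (Request V)) :
    ∀ τ r, onlineCostFrom A τ (r :: σ)
      = scheduleCost (some (A τ)) (r :: σ) (fun i => A (τ ++ (r :: σ).take (i + 1))) := by
  induction σ with
  | nil => intro τ r; simp [onlineCostFrom, scheduleCost_singleton]
  | cons r' σ ih =>
    intro τ r
    rw [onlineCostFrom, ih, scheduleCost_cons_cons]
    simp

/-- The adversary argument pretends that the algorithm starts in `A []`; replacing the true start by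
this one costs at most `n ^ 2`. -/
theorem onlineCostFrom_nil_le (start : Option (Configuration V n)) (A : OnlineAlgorithm V n)
    (σ : List (Request V)) : onlineCostFrom A [] σ ≤ onlineCost start A σ + n ^ 2 := by
  cases σ with
  | nil => simp [onlineCostFrom]
  | cons r σ =>
    rw [onlineCostFrom_eq_scheduleCost]
    exact scheduleCost_some_le _ _ _ _

theorem offlineCost_le (start : Option (Configuration V n)) (σ : List (Request V))
    (h : ℕ → Configuration V n) : offlineCost start σ ≤ scheduleCost start σ h :=
  ciInf_le (OrderBot.bddBelow _) h

theorem scheduleCost_const_le (start : Option (Configuration V n)) (g : Configuration V n)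
    (σ : List (Request V)) (hσ : ∀ r ∈ σ, servingCost g r ≤ 1) :
    scheduleCost start σ (fun _ => g) ≤ n ^ 2 + σ.length := by
  have h1 := startCost_le_sq start g
  have h2 : ∑ i : Fin σ.length, servingCost g (σ.get i) ≤ ∑ _i : Fin σ.length, 1 :=
    Finset.sum_le_sum fun i _ => hσ _ (List.get_mem σ i)
  simp only [scheduleCost, reconfigurationCost_self, Finset.sum_const_zero]
  simp only [Finset.sum_const, Finset.card_univ, Fintype.card_fin, smul_eq_mul, mul_one] at h2
  omega

/-- One offline phase: move to `g`, serve `σ` there at unit cost, and leave `g` as the start for the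
rest. -/
theorem exists_scheduleCost_append_le (g : Configuration V n) (σ' : List (Request V)) (B : ℕ)
    (hne : σ' ≠ []) (hB : ∃ h, scheduleCost (some g) σ' h ≤ B) (σ : List (Request V))
    (hσ : ∀ r ∈ σ, servingCost g r ≤ 1) (s : Configuration V n) :
    ∃ h, scheduleCost (some s) (σ ++ σ') h ≤ n ^ 2 + σ.length + B := by
  have key : ∃ h, scheduleCost (some g) (σ ++ σ') h ≤ σ.length + B := by
    induction σ with
    | nil => simpa using hB
    | cons r σ ih =>
      obtain ⟨h, hh⟩ := ih fun r hr => hσ r (List.mem_cons_of_mem _ hr)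
      refine ⟨fun i => Nat.casesOn i g h, ?_⟩
      have h1 := hσ r List.mem_cons_self
      obtain ⟨r', ρ, hρ⟩ := List.exists_cons_of_ne_nil (List.append_ne_nil_of_right_ne_nil σ hne)
      rw [List.cons_append, hρ, scheduleCost_cons_cons, ← hρ]
      show reconfigurationCost g g + servingCost g r + scheduleCost (some g) (σ ++ σ') h ≤ _
      rw [reconfigurationCost_self, List.length_cons]
      omega
  obtain ⟨h, hh⟩ := key
  have h1 := scheduleCost_some_triangle s g (σ ++ σ') h
  have h2 := reconfigurationCost_le_sq s g
  exact ⟨h, by omega⟩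

/-- Distinct nodes are at distance at least one. This keeps the denominator of `costRatio` positive.
-/
theorem length_le_scheduleCost (start : Option (Configuration V n)) (σ : List (Request V))
    (hσ : ∀ r ∈ σ, r.1 ≠ r.2) (h : ℕ → Configuration V n) :
    σ.length ≤ scheduleCost start σ h := by
  have h2 : ∑ _i : Fin σ.length, 1 ≤ ∑ i : Fin σ.length, servingCost (h i) (σ.get i) := by
    refine Finset.sum_le_sum fun i _ => ?_
    have h3 : h i (σ.get i).1 ≠ h i (σ.get i).2 :=
      fun hc => hσ _ (List.get_mem σ i) ((h i).injective hc)
    rw [ne_eq, Fin.ext_iff] at h3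
    unfold servingCost
    omega
  simp only [Finset.sum_const, Finset.card_univ, Fintype.card_fin, smul_eq_mul, mul_one] at h2
  unfold scheduleCost
  omega

/-- A lower bound on the ratio of the costs from an upper bound on the offline cost. -/
theorem le_costRatio (start : Option (Configuration V n)) (A : OnlineAlgorithm V n)
    (σ : List (Request V)) (hσ : ∀ r ∈ σ, r.1 ≠ r.2) (hne : σ ≠ []) (C : ℝ) (hC : 0 ≤ C)
    (B : ℕ) (hB : offlineCost start σ ≤ B)
    (h : C * B + (n : ℝ) ^ 2 ≤ (onlineCostFrom A [] σ : ℝ)) : C ≤ costRatio start A σ := by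
  have : Nonempty (ℕ → Configuration V n) := ⟨fun _ => A []⟩
  have h1 : σ.length ≤ offlineCost start σ :=
    le_ciInf fun h => length_le_scheduleCost start σ hσ h
  have h2 := List.length_pos_iff.2 hne
  have h3 : (0 : ℝ) < (offlineCost start σ : ℝ) := by exact_mod_cast (by omega : 0 < _)
  have h4 : (onlineCostFrom A [] σ : ℝ) ≤ (onlineCost start A σ : ℝ) + (n : ℝ) ^ 2 := by
    exact_mod_cast onlineCostFrom_nil_le start A σ
  have h5 : (offlineCost start σ : ℝ) ≤ (B : ℝ) := by exact_mod_cast hB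
  rw [costRatio, le_div_iff₀ h3]
  have h6 := mul_le_mul_of_nonneg_left h5 hC
  linarith

/-! ### Families of disjoint paths -/

/-- `p j 0, …, p j (s - 1)` for `j < M` are `M` disjoint paths with `s` nodes each. -/
def IsPathFamily (M s : ℕ) (p : ℕ → ℕ → V) : Prop :=
  ∀ j < M, ∀ t < s, ∀ j' < M, ∀ t' < s, p j t = p j' t' → j = j' ∧ t = t'

/-- The edges of the paths of a family. -/
def pathEdges (M s : ℕ) (p : ℕ → ℕ → V) : Set (Request V) :=
  {e | ∃ j t, j < M ∧ t + 1 < s ∧ e = (p j t, p j (t + 1))}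

/-- If all edges of a path are short, then so is the distance of any two of its nodes. -/
theorem dist_le_of_short {M s L : ℕ} {p : ℕ → ℕ → V} {h : Configuration V n}
    (hL : ∀ e ∈ pathEdges M s p, servingCost h e < L) {j : ℕ} (hj : j < M) (t d : ℕ)
    (htd : t + d < s) : ((h (p j t) : ℤ) - h (p j (t + d))).natAbs ≤ d * L := by
  induction d with
  | zero => simp
  | succ d ih =>
    have h1 := ih (by omega)
    have h2 := hL _ ⟨j, t + d, hj, by omega, rfl⟩
    simp only [servingCost] at h2
    rw [add_mul, one_mul, ← add_assoc]
    omega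

/-- The paths of a family can be sorted by the positions of their first nodes. -/
theorem exists_sorting (h : Configuration V n) (p : ℕ → ℕ → V) (M : ℕ) :
    ∃ ρ : ℕ → ℕ, (∀ j < M, ρ j < M) ∧ (∀ j < M, ∀ j' < M, ρ j = ρ j' → j = j') ∧
      (∀ i < M, ∃ j < M, ρ j = i) ∧
      ∀ j j', j ≤ j' → j' < M → h (p (ρ j) 0) ≤ h (p (ρ j') 0) := by
  let f : Fin M → Fin n := fun j => h (p j 0)
  refine ⟨fun j => if hj : j < M then (Tuple.sort f ⟨j, hj⟩ : ℕ) else 0, ?_, ?_, ?_, ?_⟩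
  · intro j hj
    simp [hj]
  · intro j hj j' hj' he
    simpa [hj, hj', ← Fin.ext_iff] using he
  · intro i hi
    refine ⟨(Tuple.sort f).symm ⟨i, hi⟩, Fin.isLt _, ?_⟩
    simp
  · intro j j' hjj hj'
    have hj : j < M := by omega
    have := Tuple.monotone_sort f (show (⟨j, hj⟩ : Fin M) ≤ ⟨j', hj'⟩ from hjj)
    simpa [hj, hj', f] using this

/-- Paths whose nodes are near each other can be merged in pairs of distant ones. -/
theorem exists_distant_merge {H s W : ℕ} (hs : 0 < s) {p : ℕ → ℕ → V} (h : Configuration V n)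
    (hp : IsPathFamily (2 * H) s p)
    (hW : ∀ j < 2 * H, ∀ t < s, ((h (p j 0) : ℤ) - h (p j t)).natAbs ≤ W) :
    ∃ q : ℕ → ℕ → V, IsPathFamily H (2 * s) q ∧
      pathEdges (2 * H) s p ⊆ pathEdges H (2 * s) q ∧
      ∀ j < H, ∀ t < s, H * s ≤ ((h (q j t) : ℤ) - h (q j (s + t))).natAbs + 4 * W + 1 := by
  obtain ⟨ρ, hρ, hinj, hsurj, hmono⟩ := exists_sorting h p (2 * H)
  -- The path of rank `j` is continued by the path of rank `H + j`.
  refine ⟨fun j t => if t < s then p (ρ j) t else p (ρ (H + j)) (t - s), ?_, ?_, ?_⟩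
  · intro j hj t ht j' hj' t' ht' he
    simp only at he
    split_ifs at he with h1 h2 h2
    · have := hp _ (hρ _ (by omega)) _ h1 _ (hρ _ (by omega)) _ h2 he
      exact ⟨hinj _ (by omega) _ (by omega) this.1, this.2⟩
    · have := hp _ (hρ _ (by omega)) _ h1 _ (hρ _ (by omega)) _ (by omega) he
      have := hinj _ (by omega) _ (by omega) this.1
      omega
    · have := hp _ (hρ _ (by omega)) _ (by omega) _ (hρ _ (by omega)) _ h2 he
      have := hinj _ (by omega) _ (by omega) this.1
      omega
    · have := hp _ (hρ _ (by omega)) _ (by omega) _ (hρ _ (by omega)) _ (by omega) he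
      have h3 := hinj _ (by omega) _ (by omega) this.1
      omega
  · rintro _ ⟨i, t, hi, ht, rfl⟩
    obtain ⟨j, hj, rfl⟩ := hsurj i hi
    by_cases hjH : j < H
    · refine ⟨j, t, hjH, by omega, ?_⟩
      simp only
      rw [if_pos (by omega), if_pos (by omega)]
    · refine ⟨j - H, s + t, by omega, by omega, ?_⟩
      simp only
      rw [if_neg (by omega), if_neg (by omega), Nat.add_sub_cancel' (by omega),
        Nat.add_sub_cancel_left, add_assoc, Nat.add_sub_cancel_left]
  · intro j hj t ht
    simp only
    rw [if_pos ht, if_neg (by omega), Nat.add_sub_cancel_left]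
    -- All nodes of the paths ranked `j` to `H + j` lie within `W` of the interval between the two
    -- extreme first nodes, so that interval is long. Passing from first nodes to the nodes at index
    -- `t` loses another `2 * W`.
    have hcard : ((Finset.Icc j (H + j)) ×ˢ Finset.range s).card
        ≤ (Finset.Icc ((h (p (ρ j) 0) : ℕ) - W) (h (p (ρ (H + j)) 0) + W)).card := by
      refine Finset.card_le_card_of_injOn (fun x => (h (p (ρ x.1) x.2) : ℕ)) ?_ ?_
      · rintro ⟨r, u⟩ hx
        simp only [Finset.coe_product, Set.mem_prod, Finset.mem_coe, Finset.mem_Icc,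
          Finset.mem_range] at hx
        simp only [Finset.coe_Icc, Set.mem_Icc]
        have h1 := hW (ρ r) (hρ _ (by omega)) u hx.2
        have h2 : (h (p (ρ j) 0) : ℕ) ≤ h (p (ρ r) 0) := hmono _ _ hx.1.1 (by omega)
        have h3 : (h (p (ρ r) 0) : ℕ) ≤ h (p (ρ (H + j)) 0) := hmono _ _ hx.1.2 (by omega)
        omega
      · rintro ⟨r, u⟩ hx ⟨r', u'⟩ hx' he
        simp only [Finset.coe_product, Set.mem_prod, Finset.mem_coe, Finset.mem_Icc,
          Finset.mem_range] at hx hx'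
        have h1 := h.injective (Fin.ext he)
        have h2 := hp _ (hρ _ (by omega)) _ hx.2 _ (hρ _ (by omega)) _ hx'.2 h1
        exact Prod.ext (hinj _ (by omega) _ (by omega) h2.1) h2.2
    simp only [Finset.card_product, Nat.card_Icc, Finset.card_range] at hcard
    have h1 := hW (ρ j) (hρ _ (by omega)) t ht
    have h2 := hW (ρ (H + j)) (hρ _ (by omega)) t ht
    have h3 : H * s ≤ (H + j + 1 - j) * s := Nat.mul_le_mul_right _ (by omega)
    have h4 : (h (p (ρ j) 0) : ℕ) ≤ h (p (ρ (H + j)) 0) := hmono _ _ (by omega) (by omega)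
    omega

/-- If the nodes at distance `s` on paths with `2 * s` nodes come nearer by `D`, then at least
`D * (H * s)` positions have to be passed. -/
theorem mul_le_displacement [Fintype V] {H s D : ℕ} {q : ℕ → ℕ → V} (h h' : Configuration V n)
    (hq : IsPathFamily H (2 * s) q)
    (hD : ∀ j < H, ∀ t < s, D + ((h' (q j t) : ℤ) - h' (q j (s + t))).natAbs
      ≤ ((h (q j t) : ℤ) - h (q j (s + t))).natAbs) :
    D * (H * s) ≤ displacement h h' := by
  classical
  have h1 : ∑ x ∈ Finset.range H ×ˢ Finset.range (s + s),
      ((h (q x.1 x.2) : ℤ) - h' (q x.1 x.2)).natAbs ≤ displacement h h' := by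
    rw [displacement,
      ← Finset.sum_image (s := Finset.range H ×ˢ Finset.range (s + s)) (g := fun x => q x.1 x.2)
        (f := fun v => ((h v : ℤ) - h' v).natAbs)]
    · exact Finset.sum_le_sum_of_subset (Finset.subset_univ _)
    · rintro ⟨r, u⟩ hx ⟨r', u'⟩ hx' he
      simp only [Finset.coe_product, Set.mem_prod, Finset.mem_coe, Finset.mem_range] at hx hx'
      have := hq _ hx.1 _ (by omega) _ hx'.1 _ (by omega) he
      exact Prod.ext this.1 this.2
  refine le_trans ?_ h1
  rw [Finset.sum_product]
  -- Two nodes that come nearer by `D` are together displaced by at least `D`, and the pairs are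
  -- disjoint.
  have h2 : ∀ j ∈ Finset.range H, s * D ≤ ∑ t ∈ Finset.range (s + s),
      ((h (q j t) : ℤ) - h' (q j t)).natAbs := by
    intro j hj
    rw [Finset.sum_range_add, ← Finset.sum_add_distrib]
    have := Finset.card_nsmul_le_sum (Finset.range s) (fun t =>
      ((h (q j t) : ℤ) - h' (q j t)).natAbs + ((h (q j (s + t)) : ℤ) - h' (q j (s + t))).natAbs) D
      (fun t ht => by
        have := hD j (Finset.mem_range.1 hj) t (Finset.mem_range.1 ht)
        omega)
    simpa using this
  have h3 := Finset.card_nsmul_le_sum _ _ _ h2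
  rw [Finset.card_range, smul_eq_mul] at h3
  calc D * (H * s) = H * (s * D) := by ring
    _ ≤ _ := h3

/-- The paths of a family can be placed one after the other on the list network. -/
theorem exists_configuration_of_isPathFamily {M s : ℕ} {p : ℕ → ℕ → V} (h : Configuration V n)
    (hp : IsPathFamily M s p) :
    ∃ g : Configuration V n, ∀ j < M, ∀ t < s, (g (p j t) : ℕ) = s * j + t := by
  rcases Nat.eq_zero_or_pos s with rfl | hs
  · exact ⟨h, by simp⟩
  have hlt : ∀ i : Fin (s * M), (i : ℕ) / s < M ∧ (i : ℕ) % s < s :=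
    fun i => ⟨Nat.div_lt_of_lt_mul i.isLt, Nat.mod_lt _ hs⟩
  let x : Fin (s * M) ↪ Fin n := ⟨fun i => h (p ((i : ℕ) / s) ((i : ℕ) % s)), by
    intro i i' he
    have h1 := hp _ (hlt i).1 _ (hlt i).2 _ (hlt i').1 _ (hlt i').2 (h.injective he)
    refine Fin.ext ?_
    rw [← Nat.div_add_mod (i : ℕ) s, h1.1, h1.2, Nat.div_add_mod]⟩
  have hcard : s * M ≤ n := by simpa using Fintype.card_le_of_embedding x
  -- Multiple transitivity of the symmetric group extends the partial placement to all nodes.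
  obtain ⟨e, he⟩ := (MulAction.isMultiplyPretransitive_iff.1
    (Equiv.Perm.isMultiplyPretransitive (Fin n) (s * M))) x (Fin.castLEEmb hcard)
  refine ⟨h.trans e, fun j hj t ht => ?_⟩
  have hi : s * j + t < s * M := by
    calc s * j + t < s * (j + 1) := by rw [mul_add, mul_one]; omega
      _ ≤ s * M := Nat.mul_le_mul_left _ hj
  have h1 := DFunLike.congr_fun he ⟨s * j + t, hi⟩
  have h2 : x ⟨s * j + t, hi⟩ = h (p j t) := by
    change h (p ((s * j + t) / s) ((s * j + t) % s)) = h (p j t)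
    rw [Nat.mul_add_div hs, Nat.div_eq_of_lt ht, add_zero, Nat.mul_add_mod, Nat.mod_eq_of_lt ht]
  rw [Function.Embedding.smul_apply, h2] at h1
  have h3 := congrArg Fin.val h1
  simpa using h3

/-! ### The adversary -/

/-- Requesting edges that are long in the current configuration of the online algorithm, the
adversary either uses up the budget of `B` requests, each at a cost of at least `L`, or forces the
algorithm to make all edges short. -/
theorem exists_requests_of_edges (A : OnlineAlgorithm V n) (E : Set (Request V)) (L B : ℕ) :
    ∀ τ, ∃ σ : List (Request V), σ.length ≤ B ∧ (∀ r ∈ σ, r ∈ E) ∧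
      L * σ.length ≤ onlineCostFrom A τ σ ∧
      (σ.length = B ∨ ∀ e ∈ E, servingCost (A (τ ++ σ)) e < L) := by
  induction B with
  | zero => exact fun τ => ⟨[], by simp⟩
  | succ B ih =>
    intro τ
    by_cases hE : ∀ e ∈ E, servingCost (A τ) e < L
    · exact ⟨[], by simp, by simp, by simp, Or.inr (by simpa using hE)⟩
    · push Not at hE
      obtain ⟨r, hr, hL⟩ := hE
      obtain ⟨σ, h1, h2, h3, h4⟩ := ih (τ ++ [r])
      refine ⟨r :: σ, by simpa using h1, ?_, ?_, ?_⟩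
      · intro e he
        rcases List.mem_cons.1 he with rfl | he
        · exact hr
        · exact h2 e he
      · have := servingCost_add_le_onlineCostFrom_cons A τ σ r
        rw [List.length_cons, mul_add, mul_one]
        omega
      · simpa using h4

/-- Merging paths `i` times, the adversary either uses up the budget, or forces the algorithm to
reorganize the list `i` times. -/
theorem exists_requests_of_merges (A : OnlineAlgorithm V n) (τ : List (Request V)) (k L B : ℕ)
    (hk : 2 ^ k ≤ n) (hL : 24 * (2 ^ (k / 2) * L) + 4 ≤ 2 ^ k) :
    ∀ i, 2 * i ≤ k → ∃ σ : List (Request V), σ.length ≤ B ∧ L * σ.length ≤ onlineCostFrom A τ σ ∧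
      ∃ l ≤ k, ∃ p : ℕ → ℕ → V, IsPathFamily (2 ^ (k - l)) (2 ^ l) p ∧
        (∀ r ∈ σ, r ∈ pathEdges (2 ^ (k - l)) (2 ^ l) p) ∧
        (σ.length = B ∨ l = i ∧
          (∀ e ∈ pathEdges (2 ^ (k - l)) (2 ^ l) p, servingCost (A (τ ++ σ)) e < L) ∧
          i * (2 ^ k) ^ 2 ≤ 16 * onlineCostFrom A τ σ) := by
  let _ : Fintype V := Fintype.ofEquiv _ (A []).symm
  intro i
  induction i with
  | zero =>
    intro _
    have hn : 0 < n := (Nat.two_pow_pos k).trans_le hk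
    -- Single nodes have no edges, so all edges are trivially short. The default position is never
    -- used, as `j < 2 ^ k ≤ n`.
    refine ⟨[], by simp, by simp, 0, by simp,
      fun j _ => (A []).symm (if hj : j < n then ⟨j, hj⟩ else ⟨0, hn⟩), ?_, by simp, ?_⟩
    · intro j hj t ht j' hj' t' ht' he
      simp only [Nat.sub_zero, pow_zero] at hj hj' ht ht'
      simp only at he
      rw [dif_pos (by omega), dif_pos (by omega), Equiv.apply_eq_iff_eq, Fin.mk.injEq] at he
      omega
    · right
      refine ⟨rfl, ?_, by simp⟩
      rintro _ ⟨j, t, _, ht, _⟩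
      simp at ht
  | succ i ih =>
    intro hi
    obtain ⟨σ, h1, h2, l, hl, p, hp, hσ, hor⟩ := ih (by omega)
    rcases hor with hB | ⟨rfl, hshort, hcost⟩
    · exact ⟨σ, h1, h2, l, hl, p, hp, hσ, Or.inl hB⟩
    have hM : 2 ^ (k - l) = 2 * 2 ^ (k - (l + 1)) := by
      rw [← pow_succ']; congr 1; omega
    have hs : 2 ^ (l + 1) = 2 * 2 ^ l := pow_succ' 2 l
    have hK : 2 ^ k = 2 * (2 ^ (k - (l + 1)) * 2 ^ l) := by
      rw [← pow_add, ← pow_succ']; congr 1; omega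
    rw [hM] at hp hσ hshort
    obtain ⟨q, hq, hsub, hfar⟩ := exists_distant_merge (W := 2 ^ l * L) (Nat.two_pow_pos l)
      (A (τ ++ σ)) hp (by
        intro j hj t ht
        have := dist_le_of_short hshort hj 0 t (by omega)
        rw [zero_add] at this
        exact this.trans (Nat.mul_le_mul_right _ ht.le))
    obtain ⟨σ', h1', h2', h3', h4'⟩ := exists_requests_of_edges A
      (pathEdges (2 ^ (k - (l + 1))) (2 * 2 ^ l) q) L (B - σ.length) (τ ++ σ)
    have happ := onlineCostFrom_append A σ σ' τ
    refine ⟨σ ++ σ', by rw [List.length_append]; omega, ?_, l + 1, by omega, q, by rwa [hs], ?_, ?_⟩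
    · rw [List.length_append, mul_add]
      omega
    · rw [hs]
      intro r hr
      rcases List.mem_append.1 hr with hr | hr
      · exact hsub (hσ r hr)
      · exact h2' r hr
    · rcases h4' with h4' | h4'
      · left
        rw [List.length_append]
        omega
      · right
        refine ⟨rfl, by rwa [hs, ← List.append_assoc], ?_⟩
        have hW : 2 ^ l * L ≤ 2 ^ (k / 2) * L :=
          Nat.mul_le_mul_right _ (Nat.pow_le_pow_right (by norm_num) (by omega))
        set X := 2 ^ (k - (l + 1)) * 2 ^ l with hX
        -- With `W = 2 ^ l * L`, partners are at least `X - 4 * W - 1` apart after the merge and at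
        -- most `W` apart once the new edges are short.
        have hdisp := mul_le_displacement (D := X - 5 * (2 ^ l * L) - 1) (A (τ ++ σ))
          (A (τ ++ σ ++ σ')) hq (by
            intro j hj t ht
            have h5 := hfar j hj t ht
            have h6 := dist_le_of_short h4' hj t (2 ^ l) (by omega)
            rw [add_comm t] at h6
            omega)
        have h5 := displacement_le (A (τ ++ σ)) (A (τ ++ σ ++ σ'))
        have h6 := reconfigurationCost_le_onlineCostFrom A σ' (τ ++ σ)
        -- By `hL` the loss is at most half of `X`. The displacement is thus at least `X ^ 2 / 2`,
        -- which needs `X ^ 2 / 4 = (2 ^ k) ^ 2 / 16` migrations.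
        have h7 : X * X ≤ 2 * (X - 5 * (2 ^ l * L) - 1) * X :=
          Nat.mul_le_mul_right _ (by omega)
        rw [← hX] at hdisp
        have h8 : (2 ^ k) ^ 2 = 4 * (X * X) := by rw [hK]; ring
        have h9 : 2 * (X - 5 * (2 ^ l * L) - 1) * X = 2 * ((X - 5 * (2 ^ l * L) - 1) * X) := by ring
        rw [happ, add_mul, one_mul]
        omega

/-- The requests along the line on which the nodes are placed by `g`. -/
def lineRequests (g : Configuration V n) : List (Request V) :=
  List.ofFn fun i : Fin (n - 1) =>
    (g.symm ⟨i, by omega⟩, g.symm ⟨i + 1, by omega⟩)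

theorem mem_lineRequests (g : Configuration V n) (r : Request V) :
    r ∈ lineRequests g ↔ (g r.1 : ℕ) + 1 = g r.2 := by
  rw [lineRequests, List.mem_ofFn]
  constructor
  · rintro ⟨i, rfl⟩
    simp
  · intro h
    have h1 := (g r.2).isLt
    refine ⟨⟨g r.1, by omega⟩, Prod.ext ?_ ?_⟩
    · simp
    · simp [h]

/-- The requests of the adversary follow a line on which the nodes are placed by some configuration
`g`. -/
theorem exists_requests_along_line (A : OnlineAlgorithm V n) (τ : List (Request V)) (k L m : ℕ)
    (hn : 2 ≤ n) (hk : 2 ^ k ≤ n) (hL : 24 * (2 ^ (k / 2) * L) + 4 ≤ 2 ^ k) (hm : n ≤ m) :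
    ∃ (σ : List (Request V)) (g : Configuration V n), σ.length = m ∧
      (∀ r, r ∈ σ ↔ (g r.1 : ℕ) + 1 = g r.2) ∧
      (L * (m - n) ≤ onlineCostFrom A τ σ ∨ k / 2 * (2 ^ k) ^ 2 ≤ 16 * onlineCostFrom A τ σ) := by
  obtain ⟨σ, h1, h2, l, hl, p, hp, hσ, hor⟩ :=
    -- The budget `m - n` leaves room to request every edge of the line once; copies of one edge
    -- then pad the length to `m`.
    exists_requests_of_merges A τ k L (m - n) hk hL (k / 2) (by omega)
  obtain ⟨g, hg⟩ := exists_configuration_of_isPathFamily (A []) hp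
  have hσg : ∀ r ∈ σ, r ∈ lineRequests g := by
    intro r hr
    obtain ⟨j, t, hj, ht, rfl⟩ := hσ r hr
    rw [mem_lineRequests, hg j hj t (by omega), hg j hj (t + 1) ht, add_assoc]
  set e : Request V := (g.symm ⟨0, by omega⟩, g.symm ⟨1, by omega⟩) with he
  have heg : e ∈ lineRequests g := by
    rw [mem_lineRequests, he]; simp
  set ρ := lineRequests g ++ List.replicate (m - (n - 1) - σ.length) e with hρ
  have hcost : onlineCostFrom A τ σ ≤ onlineCostFrom A τ (σ ++ ρ) := by
    rw [onlineCostFrom_append]; omega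
  refine ⟨σ ++ ρ, g, ?_, fun r => ?_, ?_⟩
  · rw [List.length_append, hρ, List.length_append, List.length_replicate, lineRequests,
      List.length_ofFn]
    omega
  · rw [← mem_lineRequests, hρ, List.mem_append, List.mem_append]
    refine ⟨?_, fun h => Or.inr (Or.inl h)⟩
    rintro (h | h | h)
    · exact hσg r h
    · exact h
    · rw [List.eq_of_mem_replicate h]; exact heg
  · rcases hor with hB | ⟨-, -, h3⟩
    · left
      rw [← hB]
      exact h2.trans hcost
    · right
      omega

/-! ### Estimates in terms of `log n` -/

theorem two_pow_half_mul_le {k : ℕ} (hk : 32 ≤ k) : 24 * (2 ^ (k / 2) * k ^ 2) + 4 ≤ 2 ^ k := by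
  have key : ∀ j, 16 ≤ j → 24 * (2 * j + 1) ^ 2 + 4 ≤ 2 ^ j := by
    intro j hj
    induction j, hj using Nat.le_induction with
    | base => norm_num
    | succ j hj ih =>
      rw [pow_succ 2 j]
      nlinarith
  have h1 := key (k / 2) (by omega)
  have h2 : k ^ 2 ≤ (2 * (k / 2) + 1) ^ 2 := Nat.pow_le_pow_left (by omega) 2
  have h3 : 2 ^ (k / 2) * 2 ^ (k / 2) ≤ 2 ^ k := by
    rw [← pow_add]
    exact Nat.pow_le_pow_right (by norm_num) (by omega)
  have h4 := Nat.two_pow_pos (k / 2)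
  nlinarith

/-- The cost forced by the adversary, in terms of `log n`. -/
theorem exists_requests_along_line_log (hn : 2 ^ 32 ≤ n) (A : OnlineAlgorithm V n)
    (τ : List (Request V)) (m : ℕ) (hm : 2 * n ≤ m) :
    ∃ (σ : List (Request V)) (g : Configuration V n), σ.length = m ∧
      (∀ r, r ∈ σ ↔ (g r.1 : ℕ) + 1 = g r.2) ∧
      (Real.log n ^ 2 * m ≤ 8 * (onlineCostFrom A τ σ : ℝ) ∨
        Real.log n * (n : ℝ) ^ 2 ≤ 256 * (onlineCostFrom A τ σ : ℝ)) := by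
  have hn0 : n ≠ 0 := by omega
  set k := Nat.log 2 n with hk
  have hk32 : 32 ≤ k := (Nat.le_log_iff_pow_le (by norm_num) hn0).2 hn
  have hkn : 2 ^ k ≤ n := Nat.pow_log_le_self 2 hn0
  have hnk : n < 2 ^ (k + 1) := Nat.lt_pow_succ_log_self (by norm_num) n
  have hlog0 : 0 ≤ Real.log n := Real.log_natCast_nonneg n
  have hlog : Real.log n ≤ k + 1 := by
    have h1 : Real.log n ≤ Real.log ((2 : ℝ) ^ (k + 1)) :=
      Real.log_le_log (by positivity) (by exact_mod_cast hnk.le)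
    rw [Real.log_pow] at h1
    have h2 : Real.log 2 ≤ 1 := by have := Real.log_two_lt_d9; linarith
    push_cast at h1
    nlinarith
  have hk32' : (32 : ℝ) ≤ k := by exact_mod_cast hk32
  obtain ⟨σ, g, h1, h2, h3⟩ := exists_requests_along_line A τ k (k ^ 2) m (by omega) hkn
    (two_pow_half_mul_le hk32) (by omega)
  refine ⟨σ, g, h1, h2, h3.imp (fun h => ?_) (fun h => ?_)⟩
  · have h4 : k ^ 2 * m ≤ 2 * onlineCostFrom A τ σ := by
      -- Since `2 * n ≤ m`, reserving `n` requests loses at most half of them.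
      have : k ^ 2 * m ≤ k ^ 2 * (2 * (m - n)) := Nat.mul_le_mul_left _ (by omega)
      linarith
    have h5 : (k : ℝ) ^ 2 * m ≤ 2 * (onlineCostFrom A τ σ : ℝ) := by exact_mod_cast h4
    have h6 : Real.log n ^ 2 ≤ 4 * (k : ℝ) ^ 2 := by nlinarith
    have h7 := mul_le_mul_of_nonneg_right h6 (Nat.cast_nonneg (α := ℝ) m)
    linarith
  · have h4 : (k - 1) * n ^ 2 ≤ 128 * onlineCostFrom A τ σ := by
      have h5 : n ^ 2 ≤ 4 * (2 ^ k) ^ 2 := by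
        rw [show 4 * (2 ^ k) ^ 2 = (2 ^ (k + 1)) ^ 2 by ring]
        exact Nat.pow_le_pow_left hnk.le 2
      calc (k - 1) * n ^ 2 ≤ (2 * (k / 2)) * (4 * (2 ^ k) ^ 2) := Nat.mul_le_mul (by omega) h5
        _ = 8 * (k / 2 * (2 ^ k) ^ 2) := by ring
        _ ≤ _ := by omega
    have h5 : ((k : ℝ) - 1) * (n : ℝ) ^ 2 ≤ 128 * (onlineCostFrom A τ σ : ℝ) := by
      have h6 : ((k - 1 : ℕ) : ℝ) = (k : ℝ) - 1 := by
        rw [Nat.cast_sub (by omega), Nat.cast_one]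
      rw [← h6]
      exact_mod_cast h4
    have h7 : Real.log n ≤ 2 * ((k : ℝ) - 1) := by linarith
    have h8 := mul_le_mul_of_nonneg_right h7 (sq_nonneg (n : ℝ))
    linarith

/-! ### Phases and competitive ratios -/

theorem servingCost_le_one {g : Configuration V n} {r : Request V}
    (h : (g r.1 : ℕ) + 1 = g r.2) : servingCost g r ≤ 1 := by
  unfold servingCost
  omega

theorem ne_of_consecutive {g : Configuration V n} {r : Request V}
    (h : (g r.1 : ℕ) + 1 = g r.2) : r.1 ≠ r.2 := by
  intro hc
  rw [hc] at h
  omega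

/-- If the requests are the pairs of neighbours on the line given by `g`, then the request graph is
a path. -/
theorem nonempty_requestGraph_iso (g : Configuration V n) (σ : List (Request V))
    (h : ∀ r, r ∈ σ ↔ (g r.1 : ℕ) + 1 = g r.2) :
    Nonempty (requestGraph σ ≃g SimpleGraph.pathGraph n) := by
  refine ⟨g, fun {u v} => ?_⟩
  rw [SimpleGraph.pathGraph_adj, requestGraph, SimpleGraph.fromRel_adj, h, h]
  refine ⟨fun huv => ⟨?_, huv⟩, fun huv => huv.2⟩
  rintro rfl
  omega

/-- The adversary can be run in consecutive phases. -/
theorem exists_requests_of_phases (hn : 2 ^ 32 ≤ n) (hlog : 1 ≤ Real.log n)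
    (A : OnlineAlgorithm V n) (m : ℕ) : n ^ 2 ≤ m → ∀ τ : List (Request V),
    ∃ σ : List (Request V), σ.length = m ∧ (∀ r ∈ σ, r.1 ≠ r.2) ∧
      Real.log n * m ≤ 512 * (onlineCostFrom A τ σ : ℝ) ∧
      ∀ s : Configuration V n, ∃ h, scheduleCost (some s) σ h ≤ 2 * m := by
  have hphase : ∀ (τ : List (Request V)) (m : ℕ), n ^ 2 ≤ m → m ≤ 2 * n ^ 2 →
      ∃ (σ : List (Request V)) (g : Configuration V n), σ.length = m ∧
        (∀ r, r ∈ σ ↔ (g r.1 : ℕ) + 1 = g r.2) ∧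
        Real.log n * m ≤ 512 * (onlineCostFrom A τ σ : ℝ) := by
    intro τ m hm hm'
    obtain ⟨σ, g, h1, h2, h3⟩ := exists_requests_along_line_log hn A τ m (by nlinarith)
    refine ⟨σ, g, h1, h2, ?_⟩
    have hm0 : (0 : ℝ) ≤ m := Nat.cast_nonneg m
    rcases h3 with h3 | h3
    · have h4 : Real.log n * m ≤ Real.log n ^ 2 * m :=
        mul_le_mul_of_nonneg_right (by nlinarith) hm0
      have h5 : (0 : ℝ) ≤ (onlineCostFrom A τ σ : ℝ) := Nat.cast_nonneg _
      linarith
    · have h4 : (m : ℝ) ≤ 2 * (n : ℝ) ^ 2 := by exact_mod_cast hm'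
      have h5 := mul_le_mul_of_nonneg_left h4 (by linarith : 0 ≤ Real.log n)
      linarith
  induction m using Nat.strong_induction_on with
  | _ m ih =>
    intro hm τ
    have hn2 : 0 < n ^ 2 := by positivity
    -- A phase of `n ^ 2` requests is split off only if more than `n ^ 2` remain, so the last phase
    -- has between `n ^ 2` and `2 * n ^ 2`. Each phase is at least as long as the offline move of
    -- cost `n ^ 2` that precedes it, whence `2 * m`.
    rcases le_or_gt m (2 * n ^ 2) with hm2 | hm2
    · obtain ⟨σ, g, h1, h2, h3⟩ := hphase τ m hm hm2
      refine ⟨σ, h1, fun r hr => ne_of_consecutive ((h2 r).1 hr), h3, fun s => ⟨fun _ => g, ?_⟩⟩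
      have := scheduleCost_const_le (some s) g σ fun r hr => servingCost_le_one ((h2 r).1 hr)
      omega
    · obtain ⟨σ, g, h1, h2, h3⟩ := hphase τ (n ^ 2) le_rfl (by omega)
      obtain ⟨σ', h1', h2', h3', h4'⟩ := ih (m - n ^ 2) (by omega) (by omega) (τ ++ σ)
      refine ⟨σ ++ σ', by rw [List.length_append]; omega, ?_, ?_, fun s => ?_⟩
      · intro r hr
        rcases List.mem_append.1 hr with hr | hr
        · exact ne_of_consecutive ((h2 r).1 hr)
        · exact h2' r hr
      · rw [onlineCostFrom_append]
        rw [Nat.cast_sub (by omega)] at h3'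
        push_cast at h3 h3' ⊢
        linarith
      · obtain ⟨h, hh⟩ := exists_scheduleCost_append_le g σ' (2 * (m - n ^ 2))
          (List.ne_nil_of_length_pos (by omega)) (h4' g) σ
          (fun r hr => servingCost_le_one ((h2 r).1 hr)) s
        exact ⟨h, by omega⟩

/-- Half of the forced cost `log n * m / 512` pays for the ratio against `2 * m`; the other half is
at least `m` and covers the error `n ^ 2` of the start. -/
theorem exists_log_costRatio_of_sq_le (hn : 2 ^ 32 ≤ n) (hlog : 1024 ≤ Real.log n)
    (start : Option (Configuration V n)) (A : OnlineAlgorithm V n) (m : ℕ) (hm : n ^ 2 ≤ m) :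
    ∃ σ : List (Request V), σ.length = m ∧ (∀ r ∈ σ, r.1 ≠ r.2) ∧
      1 / 2048 * Real.log n ≤ costRatio start A σ := by
  obtain ⟨σ, h1, h2, h3, h4⟩ := exists_requests_of_phases hn (by linarith) A m hm []
  refine ⟨σ, h1, h2, ?_⟩
  have hn2 : 0 < n ^ 2 := by positivity
  refine le_costRatio start A σ h2 (List.ne_nil_of_length_pos (by omega)) _ (by linarith)
    (2 * m) ?_ ?_
  · cases start with
    | some s =>
      obtain ⟨h, hh⟩ := h4 s
      exact (offlineCost_le _ σ h).trans hh
    | none =>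
      obtain ⟨h, hh⟩ := h4 (A [])
      refine (offlineCost_le _ σ h).trans (le_trans ?_ hh)
      simp only [scheduleCost, startCost]
      omega
  · have h5 : (n : ℝ) ^ 2 ≤ m := by exact_mod_cast hm
    have h6 := mul_le_mul_of_nonneg_right hlog (Nat.cast_nonneg (α := ℝ) m)
    push_cast
    linarith

/-- If the budget is used up, one factor `log n` of the forced cost outweighs `8 * (1 + 2 / a)`.
Otherwise `m ≤ b * n ^ 2` bounds the offline cost by `(1 + b) * n ^ 2`, so only `b` enters the
constant. -/
theorem exists_log_costRatio_along_line {a b : ℝ} (ha : 0 < a) (hb : 0 < b) (hn : 2 ^ 32 ≤ n)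
    (hlog : 512 ≤ Real.log n) (hloga : 8 * (1 + 2 / a) ≤ Real.log n) (han : 2 ≤ a * n)
    (start : Option (Configuration V n)) (A : OnlineAlgorithm V n) (m : ℕ)
    (hm : a * (n : ℝ) ^ 2 ≤ m) (hm' : (m : ℝ) ≤ b * (n : ℝ) ^ 2) :
    ∃ σ : List (Request V), σ.length = m ∧ (∀ r ∈ σ, r.1 ≠ r.2) ∧
      Nonempty (requestGraph σ ≃g SimpleGraph.pathGraph n) ∧
      1 / (512 * (1 + b)) * Real.log n ≤ costRatio start A σ := by
  have hn0 : (0 : ℝ) < n := by exact_mod_cast (by omega : 0 < n)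
  have hm2 : 2 * n ≤ m := by
    have : (2 : ℝ) * n ≤ m := by nlinarith
    exact_mod_cast this
  obtain ⟨σ, g, h1, h2, h3⟩ := exists_requests_along_line_log hn A [] m hm2
  have hne : ∀ r ∈ σ, r.1 ≠ r.2 := fun r hr => ne_of_consecutive ((h2 r).1 hr)
  refine ⟨σ, h1, hne, nonempty_requestGraph_iso g σ h2, ?_⟩
  refine le_costRatio start A σ hne (List.ne_nil_of_length_pos (by omega)) _ (by positivity)
    (n ^ 2 + m) ?_ ?_
  · rw [← h1]
    exact (offlineCost_le _ σ _).trans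
      (scheduleCost_const_le start g σ fun r hr => servingCost_le_one ((h2 r).1 hr))
  · set X : ℝ := (onlineCostFrom A [] σ : ℝ)
    set l := Real.log n
    have hm0 : (0 : ℝ) ≤ m := Nat.cast_nonneg m
    push_cast
    rcases h3 with h3 | h3
    · have h4 : (n : ℝ) ^ 2 ≤ m / a := by
        rw [le_div_iff₀ ha]; linarith
      have h5 : 1 / (512 * (1 + b)) ≤ 1 := by
        rw [div_le_one (by positivity)]; linarith
      have h6 : 1 / (512 * (1 + b)) * l * ((n : ℝ) ^ 2 + m) ≤ 1 * l * ((m : ℝ) / a + m) := by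
        gcongr
      have h7 : (m : ℝ) / a ≤ l * (m / a) := le_mul_of_one_le_left (by positivity) (by linarith)
      have h8 : 8 * (1 + 2 / a) * (l * m) ≤ l * (l * m) :=
        mul_le_mul_of_nonneg_right hloga (by positivity)
      have h9 : 8 * (1 + 2 / a) * (l * m) = 8 * (l * (m + 2 * (m / a))) := by ring
      nlinarith
    · have h4 : 1 / (512 * (1 + b)) * l * ((n : ℝ) ^ 2 + m)
          ≤ 1 / (512 * (1 + b)) * l * ((n : ℝ) ^ 2 + b * (n : ℝ) ^ 2) := by
        gcongr
      have h5 : 1 / (512 * (1 + b)) * l * ((n : ℝ) ^ 2 + b * (n : ℝ) ^ 2)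
          = l * (n : ℝ) ^ 2 / 512 := by
        field_simp
      have h6 := mul_le_mul_of_nonneg_right hlog (sq_nonneg (n : ℝ))
      linarith

theorem exists_forall_ge_log (a : ℝ) (ha : 0 < a) :
    ∃ N : ℕ, ∀ n : ℕ, N ≤ n → 2 ^ 32 ≤ n ∧ 1024 ≤ Real.log n ∧
      8 * (1 + 2 / a) ≤ Real.log n ∧ 2 ≤ a * n := by
  have hlog := Real.tendsto_log_atTop.comp tendsto_natCast_atTop_atTop
  have hlin := tendsto_natCast_atTop_atTop.const_mul_atTop ha
  exact Filter.eventually_atTop.1 ((Filter.eventually_ge_atTop (2 ^ 32)).and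
    ((hlog.eventually_ge_atTop 1024).and ((hlog.eventually_ge_atTop (8 * (1 + 2 / a))).and
      (hlin.eventually_ge_atTop 2))))

end DistributedListUpdate

theorem mainTheorem1 :
    (∃ c : ℝ, 0 < c ∧ ∀ a : ℝ, 0 < a → ∃ N : ℕ, ∀ n : ℕ, N ≤ n → ∀ (V : Type*)
      (start : Option (DistributedListUpdate.Configuration V n))
      (A : DistributedListUpdate.OnlineAlgorithm V n) (m : ℕ),
      a * (n : ℝ) ^ 2 ≤ (m : ℝ) →
      ∃ σ : List (DistributedListUpdate.Request V), σ.length = m ∧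
        (∀ r ∈ σ, r.1 ≠ r.2) ∧
        c * Real.log n ≤ DistributedListUpdate.costRatio start A σ) ∧
    (∀ b : ℝ, 0 < b → ∃ c : ℝ, 0 < c ∧ ∀ a : ℝ, 0 < a → ∃ N : ℕ, ∀ n : ℕ, N ≤ n →
      ∀ (V : Type*)
      (start : Option (DistributedListUpdate.Configuration V n))
      (A : DistributedListUpdate.OnlineAlgorithm V n) (m : ℕ),
      a * (n : ℝ) ^ 2 ≤ (m : ℝ) → (m : ℝ) ≤ b * (n : ℝ) ^ 2 →
      ∃ σ : List (DistributedListUpdate.Request V), σ.length = m ∧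
        (∀ r ∈ σ, r.1 ≠ r.2) ∧
        Nonempty (DistributedListUpdate.requestGraph σ ≃g SimpleGraph.pathGraph n) ∧
        c * Real.log n ≤ DistributedListUpdate.costRatio start A σ) := by
  refine ⟨⟨1 / 2048, by norm_num, fun a ha => ?_⟩, fun b hb =>
    ⟨1 / (512 * (1 + b)), by positivity, fun a ha => ?_⟩⟩
  · obtain ⟨N, hN⟩ := DistributedListUpdate.exists_forall_ge_log a ha
    refine ⟨N, fun n hn V start A m hm => ?_⟩
    obtain ⟨h1, h2, h3, h4⟩ := hN n hn
    rcases le_total (n ^ 2) m with h | h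
    · exact DistributedListUpdate.exists_log_costRatio_of_sq_le h1 h2 start A m h
    -- Sequences too short for a full phase are handled by the line bound with `b = 1`, whose
    -- constant is `1 / 1024`.
    · have h' : (m : ℝ) ≤ 1 * (n : ℝ) ^ 2 := by rw [one_mul]; exact_mod_cast h
      obtain ⟨σ, h5, h6, -, h7⟩ := DistributedListUpdate.exists_log_costRatio_along_line ha
        one_pos h1 (by linarith) h3 h4 start A m hm h'
      exact ⟨σ, h5, h6, by norm_num at h7 ⊢; linarith⟩
  · obtain ⟨N, hN⟩ := DistributedListUpdate.exists_forall_ge_log a ha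
    refine ⟨N, fun n hn V start A m hm hm' => ?_⟩
    obtain ⟨h1, h2, h3, h4⟩ := hN n hn
    exact DistributedListUpdate.exists_log_costRatio_along_line ha hb h1 (by linarith) h3 h4
      start A m hm hm'
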